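/- Let $X$ be a preordered set (for instance a complete Heyting algebra), regarded as a category with a unique arrow $x'\to x$ whenever $x'\le x$. Let $\mathbf{Ord}$ be the category whose objects are preordered sets (sets with a reflexive and transitive relation, not necessarily antisymmetric) and whose morphisms are monotone maps, and let $[X^{\mathrm{op}},\mathbf{Ord}]$ be the category of functors $X^{\mathrm{op}}\to\mathbf{Ord}$ and natural transformations. In a category $\mathcal C$ with pullbacks, a morphism $f\colon A\to B$ is called an effective descent morphism if the change-of-base functor $f^{*}\colon \mathcal C/B\to\mathcal C/A$, given by pulling back along $f$, is monadic. (Both $\mathbf{Ord}$ and $[X^{\mathrm{op}},\mathbf{Ord}]$ have pullbacks.) Theorem. A natural transformation $\alpha\colon F\to G$ between functors $F,G\colon X^{\mathrm{op}}\to\mathbf{Ord}$ is an effective descent morphism in $[X^{\mathrm{op}},\mathbf{Ord}]$ if and only if, for every $x\in X$, its component $\alpha_x\colon F(x)\to G(x)$ is an effective descent morphism in $\mathbf{Ord}$. -/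

import Mathlib

open CategoryTheory Limits

universe u v w

/-- A morphism `f : A ⟶ B` of a category with pullbacks is an *effective descent morphism*
if its change of base functor `f^* : Over B ⥤ Over A` is monadic. -/
def IsEffectiveDescent {C : Type u} [Category.{v} C] [HasPullbacks C] {A B : C} (f : A ⟶ B) :
    Prop :=
  Nonempty (MonadicRightAdjoint (Over.pullback f))

namespace Preord

/-- The category of preorders (and monotone maps) has pullbacks: the pullback of `f` and `g` is
`{(a, b) | f a = g b}` with the componentwise preorder. -/
instance instHasPullbacks : HasPullbacks Preord.{w} := by
  refine @hasPullbacks_of_hasLimit_cospan _ _ fun {A B Z f g} => ?_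
  let P : Preord.{w} := Preord.of {p : A × B // f p.1 = g p.2}
  let p₁ : P ⟶ A := Preord.ofHom ⟨fun p => p.1.1, fun _ _ h => h.1⟩
  let p₂ : P ⟶ B := Preord.ofHom ⟨fun p => p.1.2, fun _ _ h => h.2⟩
  have hp : p₁ ≫ f = p₂ ≫ g := Preord.ext fun p => p.2
  refine ⟨⟨⟨PullbackCone.mk p₁ p₂ hp, PullbackCone.IsLimit.mk hp
    (fun s => Preord.ofHom ⟨fun t => ⟨(s.fst t, s.snd t),
      ConcreteCategory.congr_hom s.condition t⟩,
      fun _ _ h => ⟨s.fst.hom.monotone h, s.snd.hom.monotone h⟩⟩)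
    (fun s => rfl) (fun s => rfl) (fun s m h₁ h₂ => ?_)⟩⟩⟩
  exact Preord.ext fun t => Subtype.ext (Prod.ext
    (ConcreteCategory.congr_hom h₁ t) (ConcreteCategory.congr_hom h₂ t))

end Preord

/-!
A right adjoint `R`, whose domain has coequalizers, is monadic if and only if it reflects
isomorphisms and preserves the coequalizers of `R`-split pairs (Beck, `monadic_iff`). Apply this to
`R = α^*`. The category `Preord` has coequalizers, those of a functor category are pointwise, and
for each `j` the evaluation at `j` induces a functor `Over G ⥤ Over (G.obj j)`, which has a right
adjoint and commutes with change of base (`Over.postPullbackIso`).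

* If all components of `α` are effective descent morphisms, then `α^*` reflects isomorphisms and
  preserves coequalizers of `α^*`-split pairs because both can be tested after evaluation
  (`monadic_of_jointly`).
* Conversely, evaluation at `j` has a right adjoint (right Kan extension along the inclusion of
  `j`), which is fully faithful because there are no endomorphisms of `j` besides the identity. The
  induced functor `V : Over G ⥤ Over (G.obj j)` then also has a fully faithful right adjoint `K`,
  and `K` commutes with change of base as well, by uniqueness of adjoints
  (`Over.pullbackPostRightAdjointIso`). This presents `(α.app j)^*` as a retract of `α^*`, and
  monadicity descends to it (`monadic_of_retract`): an `(α.app j)^*`-split pair is sent by `K` to an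
  `α^*`-split pair, whose coequalizer `α^*` preserves, and `V` carries this back.

Nothing about preorders is used beyond the existence of pullbacks, coequalizers and a terminal
object, so the equivalence holds for functors from any thin category to any category with these
(`isEffectiveDescent_iff_forall_app`).
-/

/-! ### Monadicity and split pairs -/

section Beck

universe v₁ v₂ v₃ v₄ u₁ u₂ u₃ u₄
variable {C : Type u₁} [Category.{v₁} C] {D : Type u₂} [Category.{v₁} D]
  {C' : Type u₃} [Category.{v₃} C'] {D' : Type u₄} [Category.{v₃} D']

theorem Functor.isSplitPair_of_iso {C : Type u₁} [Category.{v₁} C] {D : Type u₂} [Category.{v₂} D]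
    {R R' : C ⥤ D} (e : R ≅ R') {X Y : C} (f g : X ⟶ Y)
    [R.IsSplitPair f g] : R'.IsSplitPair f g := by
  obtain ⟨Z, h, ⟨s⟩⟩ := ‹R.IsSplitPair f g›
  refine ⟨Z, e.inv.app Y ≫ h, ⟨⟨s.rightSection ≫ e.hom.app Y,
    e.inv.app Y ≫ s.leftSection ≫ e.hom.app X, ?_, ?_, ?_, ?_⟩⟩⟩
  · rw [e.inv.naturality_assoc, e.inv.naturality_assoc, s.condition]
  · rw [Category.assoc, e.hom_inv_id_app_assoc, s.rightSection_π]
  · rw [Category.assoc, Category.assoc, ← e.hom.naturality, s.leftSection_bottom_assoc,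
      e.inv_hom_id_app]
  · rw [Category.assoc, Category.assoc, ← e.hom.naturality, s.leftSection_top_assoc,
      Category.assoc]

theorem preservesColimit_parallelPair_comp {C : Type u₁} [Category.{v₁} C] {D : Type u₂}
    [Category.{v₂} D] {E : Type u₃} [Category.{v₃} E] (R : D ⥤ C) (W : C ⥤ E) {X Y : D}
    (f g : X ⟶ Y) [PreservesColimit (parallelPair (R.map f) (R.map g)) W] :
    PreservesColimit (parallelPair f g ⋙ R) W :=
  have e : parallelPair (R.map f) (R.map g) ≅ parallelPair f g ⋙ R :=
    (diagramIsoParallelPair (parallelPair f g ⋙ R)).symm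
  preservesColimit_of_iso_diagram W e

/-- Split coequalizers are absolute, so a functor that preserves the coequalizer of an `R`-split
pair still does so after composition with an arbitrary functor. -/
theorem preservesColimit_comp_of_isSplitPair {C : Type u₁} [Category.{v₁} C] {D : Type u₂}
    [Category.{v₂} D] {E : Type u₃} [Category.{v₃} E] (R : D ⥤ C) (W : C ⥤ E) {X Y : D}
    (f g : X ⟶ Y) [R.IsSplitPair f g] [PreservesColimit (parallelPair f g) R] :
    PreservesColimit (parallelPair f g) (R ⋙ W) := by
  have : PreservesColimit (parallelPair f g ⋙ R) W :=
    preservesColimit_parallelPair_comp R W f g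
  infer_instance

/-- Beck's monadicity theorem as a characterization of monadic functors. -/
theorem monadic_iff [HasCoequalizers D] (R : D ⥤ C) [R.IsRightAdjoint] :
    Nonempty (MonadicRightAdjoint R) ↔
      R.ReflectsIsomorphisms ∧ ∀ ⦃X Y : D⦄ (f g : X ⟶ Y) [R.IsSplitPair f g],
        PreservesColimit (parallelPair f g) R := by
  constructor
  · rintro ⟨_⟩
    refine ⟨⟨fun {A B} f hf => ?_⟩, fun X Y f g _ => ?_⟩
    · have : IsIso ((Monad.forget _).map ((Monad.comparison (monadicAdjunction R)).map f)) := hf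
      have := isIso_of_reflects_iso ((Monad.comparison (monadicAdjunction R)).map f)
        (Monad.forget _)
      exact isIso_of_reflects_iso f (Monad.comparison (monadicAdjunction R))
    · have := Monad.createsGSplitCoequalizersOfMonadic R f g
      have : HasColimit (parallelPair f g ⋙ R) :=
        (hasColimit_iff_of_iso (diagramIsoParallelPair _)).2
          (inferInstanceAs (HasCoequalizer (R.map f) (R.map g)))
      infer_instance
  · rintro ⟨_, h⟩
    have : Monad.HasCoequalizerOfIsSplitPair R := ⟨fun f g _ => inferInstance⟩
    have : Monad.PreservesColimitOfIsSplitPair R := ⟨fun f g _ => h f g⟩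
    exact ⟨Monad.monadicOfHasPreservesGSplitCoequalizersOfReflectsIsomorphisms
      (Adjunction.ofIsRightAdjoint R)⟩

/-- If `R'` is a retract of a monadic functor `R`, by functors `K`, `M` in one direction and `V`, `W`
in the other, then `R'` is monadic. Only the retraction `K ⋙ V ≅ 𝟭 D'` on domains is needed. -/
theorem monadic_of_retract [HasCoequalizers D] [HasCoequalizers D']
    {R : D ⥤ C} {R' : D' ⥤ C'} [R'.IsRightAdjoint]
    {V : D ⥤ D'} {W : C ⥤ C'} {K : D' ⥤ D} {M : C' ⥤ C}
    [PreservesColimitsOfShape WalkingParallelPair V]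
    (vw : V ⋙ R' ≅ R ⋙ W) (km : R' ⋙ M ≅ K ⋙ R) (kv : K ⋙ V ≅ 𝟭 D')
    (hR : Nonempty (MonadicRightAdjoint R)) : Nonempty (MonadicRightAdjoint R') := by
  have : R.IsRightAdjoint := let ⟨_⟩ := hR; inferInstance
  rw [monadic_iff] at hR ⊢
  obtain ⟨_, hp⟩ := hR
  refine ⟨⟨fun {A B} f hf => ?_⟩, fun X Y f g _ => ?_⟩
  · have : IsIso (R.map (K.map f)) :=
      (NatIso.isIso_map_iff km f).1 (inferInstanceAs (IsIso (M.map (R'.map f))))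
    have := isIso_of_reflects_iso (K.map f) R
    exact (NatIso.isIso_map_iff kv f).1 (inferInstanceAs (IsIso (V.map (K.map f))))
  · have : (R' ⋙ M).IsSplitPair f g :=
      inferInstanceAs (HasSplitCoequalizer (M.map (R'.map f)) (M.map (R'.map g)))
    have : R.IsSplitPair (K.map f) (K.map g) := Functor.isSplitPair_of_iso km f g
    have := hp (K.map f) (K.map g)
    -- The coequalizer `c` of the image of the pair under `K` is preserved by `V` and by `V ⋙ R'`,
    -- so `R'` preserves the coequalizer `V c` of the original pair.
    let c := Cofork.ofπ _ (coequalizer.condition (K.map f) (K.map g))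
    have hc : IsColimit c := coequalizerIsCoequalizer _ _
    have := preservesColimit_comp_of_isSplitPair R W (K.map f) (K.map g)
    have : PreservesColimit (parallelPair (K.map f) (K.map g)) (V ⋙ R') :=
      preservesColimit_of_natIso _ vw.symm
    have : PreservesColimit (parallelPair (K.map f) (K.map g) ⋙ V) R' :=
      preservesColimit_of_preserves_colimit_cocone (isColimitOfPreserves V hc)
        (isColimitOfPreserves (V ⋙ R') hc)
    refine preservesColimit_of_iso_diagram R' (K₁ := parallelPair (K.map f) (K.map g) ⋙ V) ?_
    exact diagramIsoParallelPair _ ≪≫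
      parallelPair.ext (kv.app _) (kv.app _) (kv.hom.naturality f) (kv.hom.naturality g)

/-- A right adjoint `R` is monadic if jointly conservative families of functors `V i` on its domain and
`W i` on its codomain carry it to monadic functors `R' i`. The `W i` need not preserve coequalizers,
because the only ones they have to preserve are split. -/
theorem monadic_of_jointly {ι : Type*} [HasCoequalizers D] {R : D ⥤ C} [R.IsRightAdjoint]
    {C' D' : ι → Type*} [∀ i, Category.{v₃} (C' i)] [∀ i, Category.{v₃} (D' i)]
    [∀ i, HasCoequalizers (D' i)] (R' : ∀ i, D' i ⥤ C' i) [∀ i, (R' i).IsRightAdjoint]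
    (V : ∀ i, D ⥤ D' i) (W : ∀ i, C ⥤ C' i)
    [∀ i, PreservesColimitsOfShape WalkingParallelPair (V i)]
    (hV : ∀ ⦃A B : D⦄ (f : A ⟶ B), (∀ i, IsIso ((V i).map f)) → IsIso f)
    (hW : ∀ ⦃A B : C⦄ (f : A ⟶ B), (∀ i, IsIso ((W i).map f)) → IsIso f)
    (vw : ∀ i, V i ⋙ R' i ≅ R ⋙ W i)
    (hR : ∀ i, Nonempty (MonadicRightAdjoint (R' i))) : Nonempty (MonadicRightAdjoint R) := by
  simp only [monadic_iff] at hR ⊢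
  refine ⟨⟨fun {A B} f _ => hV f fun i => ?_⟩, fun X Y f g _ => ?_⟩
  · have := (hR i).1
    have : IsIso ((R' i).map ((V i).map f)) :=
      (NatIso.isIso_map_iff (vw i) f).2 (inferInstanceAs (IsIso ((W i).map (R.map f))))
    exact isIso_of_reflects_iso _ (R' i)
  · have (i : ι) : PreservesColimit (parallelPair f g) (R ⋙ W i) := by
      have : (R ⋙ W i).IsSplitPair f g :=
        inferInstanceAs (HasSplitCoequalizer ((W i).map (R.map f)) ((W i).map (R.map g)))
      have : (R' i).IsSplitPair ((V i).map f) ((V i).map g) :=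
        Functor.isSplitPair_of_iso (vw i).symm f g
      have := (hR i).2 ((V i).map f) ((V i).map g)
      have : PreservesColimit (parallelPair f g ⋙ V i) (R' i) :=
        preservesColimit_parallelPair_comp (V i) (R' i) f g
      exact preservesColimit_of_natIso _ (vw i)
    have : HasColimit (parallelPair f g ⋙ R) :=
      (hasColimit_iff_of_iso (diagramIsoParallelPair _)).2
        (inferInstanceAs (HasCoequalizer (R.map f) (R.map g)))
    suffices IsIso (colimit.post (parallelPair f g) R) from preservesColimit_of_isIso_post _ _
    refine hW _ fun i => ?_
    have : PreservesColimit (parallelPair f g ⋙ R) (W i) :=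
      preservesColimit_parallelPair_comp R (W i) f g
    have : HasColimit ((parallelPair f g ⋙ R) ⋙ W i) := inferInstance
    have : HasColimit (parallelPair f g ⋙ R ⋙ W i) := this
    have h : IsIso (colimit.post (parallelPair f g) (R ⋙ W i)) := inferInstance
    rw [← colimit.post_post (parallelPair f g) R (W i)] at h
    exact IsIso.of_isIso_comp_left (colimit.post (parallelPair f g ⋙ R) (W i)) _

end Beck

/-! ### Over categories and change of base along adjunctions -/

section Over

universe v₁ v₂ u₁ u₂
variable {C : Type u₁} [Category.{v₁} C] {D : Type u₂} [Category.{v₂} D]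
  [HasPullbacks C]

/-- Naturality of `PreservesPullback.iso` with respect to morphisms of one leg. -/
theorem map_pullbackLift_iso_hom [HasPullbacks D] (F : C ⥤ D)
    [PreservesLimitsOfShape WalkingCospan F] {A B S T : C} {s : S ⟶ B} {t : T ⟶ B} (f : A ⟶ B)
    (g : S ⟶ T)
    (h : (pullback.fst s f ≫ g) ≫ t = pullback.snd s f ≫ f)
    (h' : (pullback.fst (F.map s) (F.map f) ≫ F.map g) ≫ F.map t =
      pullback.snd (F.map s) (F.map f) ≫ F.map f) :
    F.map (pullback.lift (pullback.fst s f ≫ g) (pullback.snd s f) h) ≫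
        (PreservesPullback.iso F t f).hom =
      (PreservesPullback.iso F s f).hom ≫
        pullback.lift (pullback.fst (F.map s) (F.map f) ≫ F.map g) (pullback.snd _ _) h' := by
  apply pullback.hom_ext
  · rw [Category.assoc, PreservesPullback.iso_hom_fst, Category.assoc, pullback.lift_fst,
      PreservesPullback.iso_hom_fst_assoc, ← F.map_comp, ← F.map_comp, pullback.lift_fst]
  · rw [Category.assoc, PreservesPullback.iso_hom_snd, Category.assoc, pullback.lift_snd,
      PreservesPullback.iso_hom_snd, ← F.map_comp, pullback.lift_snd]

/-- A functor that preserves pullbacks commutes with change of base. -/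
noncomputable def Over.postPullbackIso [HasPullbacks D] (F : C ⥤ D)
    [PreservesLimitsOfShape WalkingCospan F] {A B : C} (f : A ⟶ B) :
    Over.post (X := B) F ⋙ Over.pullback (F.map f) ≅ Over.pullback f ⋙ Over.post F :=
  (NatIso.ofComponents (F := Over.pullback f ⋙ Over.post F)
    (G := Over.post (X := B) F ⋙ Over.pullback (F.map f))
    (fun T => Over.isoMk (PreservesPullback.iso F T.hom f)
      (PreservesPullback.iso_hom_snd F T.hom f))
    (fun g => by
      apply Over.OverMorphism.ext
      exact map_pullbackLift_iso_hom F f g.left _ _)).symm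

/-- If `F ⊣ G` with `G` fully faithful, then the right adjoint of `Over.post F` is too. -/
theorem Over.isIso_counit_postAdjunctionLeft {F : C ⥤ D} {G : D ⥤ C} (a : F ⊣ G)
    [PreservesLimitsOfShape WalkingCospan F] [IsIso a.counit] (A : C) :
    IsIso (Over.postAdjunctionLeft (X := A) a).counit := by
  suffices ∀ T, IsIso ((Over.postAdjunctionLeft (X := A) a).counit.app T) from
    NatIso.isIso_of_isIso_app _
  intro T
  suffices IsIso ((Over.forget _).map ((Over.postAdjunctionLeft (X := A) a).counit.app T)) from
    isIso_of_reflects_iso _ (Over.forget _)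
  -- The counit at `T` is a base change of `F.map (a.unit.app A)`, which is invertible by the triangle
  -- identity, followed by `a.counit.app T.left`.
  have h := a.left_triangle_components A
  have : IsIso (F.map (a.unit.app A)) := by
    rw [← IsIso.eq_comp_inv] at h
    rw [h, Category.id_comp]; infer_instance
  have : IsIso (F.map (pullback.fst (G.map T.hom) (a.unit.app A))) :=
    ((IsPullback.of_hasPullback (G.map T.hom) (a.unit.app A)).map F).isIso_fst_of_isIso
  simp
  exact IsIso.comp_isIso' this inferInstance

/-- The right adjoint of `Over.post F` provided by an adjunction `F ⊣ G` commutes with change of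
base, since both composites are right adjoint to `T ↦ (F T ⟶ F A ⟶ F B)`. -/
noncomputable def Over.pullbackPostRightAdjointIso [HasPullbacks D] {F : C ⥤ D} {G : D ⥤ C}
    (a : F ⊣ G) {A B : C} (f : A ⟶ B) :
    Over.pullback (F.map f) ⋙ Over.post G ⋙ Over.pullback (a.unit.app A) ≅
      (Over.post G ⋙ Over.pullback (a.unit.app B)) ⋙ Over.pullback f :=
  Adjunction.rightAdjointUniq
    ((Over.postAdjunctionLeft a).comp (Over.mapPullbackAdj (F.map f)))
    (((Over.mapPullbackAdj f).comp (Over.postAdjunctionLeft a)).ofNatIsoLeft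
      (NatIso.ofComponents
        (F := Over.map f ⋙ Over.post F) (G := Over.post F ⋙ Over.map (F.map f))
        (fun T => Over.isoMk (Iso.refl (F.obj T.left))
          ((Category.id_comp (F.map T.hom ≫ F.map f)).trans (F.map_comp _ _).symm))
        (fun g => Over.OverMorphism.ext
          ((Category.comp_id (F.map g.left)).trans (Category.id_comp (F.map g.left)).symm))))

end Over

/-! ### Limits and colimits in `Preord` -/

namespace Preord

instance : HasTerminal Preord.{w} := by
  have (Y : Preord.{w}) : Unique (Y ⟶ Preord.of PUnit.{w+1}) :=
    ⟨⟨Preord.ofHom ⟨fun _ => ⟨⟩, fun _ _ _ => le_rfl⟩⟩, fun _ => rfl⟩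
  exact hasTerminal_of_unique (Preord.of PUnit.{w+1})

/-- `Preord` has coequalizers: the coequalizer of `f, g : A ⟶ B` is the coequalizer of the
underlying functions, with the preorder generated by the images of the relations `b ≤ b'`
of `B`. -/
instance instHasCoequalizers : HasCoequalizers Preord.{w} := by
  refine @hasCoequalizers_of_hasColimit_parallelPair _ _ (fun {A B f g} => ?_)
  let r : Function.Coequalizer f g → Function.Coequalizer f g → Prop := fun p q =>
    ∃ b b' : B, b ≤ b' ∧ Function.Coequalizer.mk f g b = p ∧ Function.Coequalizer.mk f g b' = q
  let _ : Preorder (Function.Coequalizer f g) :=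
    { le := Relation.ReflTransGen r
      le_refl := fun _ => .refl
      le_trans := fun _ _ _ => .trans }
  let π : B ⟶ Preord.of (Function.Coequalizer f g) :=
    Preord.ofHom ⟨Function.Coequalizer.mk f g, fun b b' h => .single ⟨b, b', h, rfl, rfl⟩⟩
  refine ⟨⟨⟨Cofork.ofπ π (Preord.ext fun a => Function.Coequalizer.condition f g a),
    Cofork.IsColimit.mk' _ fun s => ?_⟩⟩⟩
  have hs : s.π ∘ f = s.π ∘ g := funext fun a => ConcreteCategory.congr_hom s.condition a
  refine ⟨Preord.ofHom ⟨Function.Coequalizer.desc f g s.π hs, fun p q h => ?_⟩, rfl,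
    fun {m} hm => ?_⟩
  · induction h with
    | refl => exact le_rfl
    | tail _ h ih =>
      obtain ⟨b, b', h, rfl, rfl⟩ := h
      exact ih.trans (s.π.hom.monotone h)
  · refine Preord.ext fun p => ?_
    obtain ⟨b, rfl⟩ := Function.Coequalizer.mk_surjective f g p
    exact ConcreteCategory.congr_hom hm b

end Preord

/-! ### Effective descent in functor categories -/

section EffectiveDescent

universe v₁ v₂ u₁ u₂
variable {C : Type u₁} [Category.{v₁} C] [HasPullbacks C] [HasCoequalizers C]

/-- A reflector that preserves pullbacks preserves effective descent morphisms. -/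
theorem IsEffectiveDescent.map {D : Type u₂} [Category.{v₂} D] [HasPullbacks D] [HasCoequalizers D]
    {F : C ⥤ D} {G : D ⥤ C} (a : F ⊣ G) [PreservesLimitsOfShape WalkingCospan F]
    [IsIso a.counit] {A B : C} {f : A ⟶ B} (hf : IsEffectiveDescent f) :
    IsEffectiveDescent (F.map f) := by
  have := Over.isIso_counit_postAdjunctionLeft a B
  have := (Over.postAdjunctionLeft (X := B) a).isLeftAdjoint
  exact monadic_of_retract (Over.postPullbackIso F f) (Over.pullbackPostRightAdjointIso a f)
    (asIso (Over.postAdjunctionLeft (X := B) a).counit) hf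

/-- A jointly conservative family of left adjoints that preserve pullbacks jointly reflects
effective descent morphisms. -/
theorem IsEffectiveDescent.of_jointly {ι : Type*} {D : ι → Type u₂} [∀ i, Category.{v₂} (D i)]
    [∀ i, HasPullbacks (D i)] [∀ i, HasCoequalizers (D i)] (F : ∀ i, C ⥤ D i)
    [∀ i, PreservesLimitsOfShape WalkingCospan (F i)] [∀ i, (F i).IsLeftAdjoint]
    (hF : ∀ ⦃A B : C⦄ (f : A ⟶ B), (∀ i, IsIso ((F i).map f)) → IsIso f)
    {A B : C} {f : A ⟶ B} (hf : ∀ i, IsEffectiveDescent ((F i).map f)) :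
    IsEffectiveDescent f := by
  have key (T : C) ⦃Y Z : Over T⦄ (g : Y ⟶ Z) (hg : ∀ i, IsIso ((Over.post (F i)).map g)) :
      IsIso g := by
    have : IsIso ((Over.forget T).map g) := hF _ fun i =>
      have := hg i
      inferInstanceAs (IsIso ((Over.forget _).map ((Over.post (F i)).map g)))
    exact isIso_of_reflects_iso g (Over.forget T)
  exact monadic_of_jointly (fun i => Over.pullback ((F i).map f)) (fun i => Over.post (F i))
    (fun i => Over.post (F i)) (key B) (key A) (fun i => Over.postPullbackIso (F i) f) hf

theorem hasProductsOfShape_of_subsingleton (D : Type u₂) [Category.{v₂} D] [HasTerminal D]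
    (ι : Type*) [Subsingleton ι] : HasProductsOfShape ι D := by
  cases isEmpty_or_nonempty ι
  · exact hasLimitsOfShape_of_equivalence
      (Discrete.equivalence (Equiv.equivOfIsEmpty PEmpty.{1} ι))
  · exact ⟨fun F => (hasLimit_iff_of_iso (Discrete.natIsoFunctor (F := F))).2 inferInstance⟩

/-- This needs `J` thin: the product indexed by `j ⟶ j` in the right adjoint of evaluation has to be
a single factor for that right adjoint to be fully faithful. -/
theorem isEffectiveDescent_iff_forall_app {J : Type u₂} [Category.{v₂} J] [Quiver.IsThin J]
    [HasTerminal C] {F G : J ⥤ C} (α : F ⟶ G) :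
    IsEffectiveDescent α ↔ ∀ j, IsEffectiveDescent (α.app j) := by
  have (a b : J) : HasProductsOfShape (a ⟶ b) C := hasProductsOfShape_of_subsingleton _ _
  refine ⟨fun h j => ?_, fun h => ?_⟩
  · have : IsIso (evaluationAdjunctionLeft C j).counit := by
      suffices ∀ d, IsIso ((evaluationAdjunctionLeft C j).counit.app d) from
        NatIso.isIso_of_isIso_app _
      intro d
      rw [evaluationAdjunctionLeft_counit_app]
      let _ : Unique (j ⟶ j) := ⟨⟨𝟙 j⟩, fun _ => Subsingleton.elim _ _⟩
      exact (productUniqueIso fun _ : j ⟶ j => d).isIso_hom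
    exact IsEffectiveDescent.map (evaluationAdjunctionLeft C j) h
  · exact IsEffectiveDescent.of_jointly (fun j => (evaluation J C).obj j)
      (fun A B f hf => (NatTrans.isIso_iff_isIso_app f).2 hf) h

end EffectiveDescent

theorem mainTheorem5 {X : Type v} [Preorder X] {F G : Xᵒᵖ ⥤ Preord.{u}} (α : F ⟶ G) :
    IsEffectiveDescent α ↔ ∀ x : X, IsEffectiveDescent (α.app (Opposite.op x)) :=
  (isEffectiveDescent_iff_forall_app α).trans ⟨fun h x => h (Opposite.op x), fun h x => h x.unop⟩
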